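/- Let $(\Omega,\mathcal F,P)$ be a probability space and let $\mathbb N=\{1,2,3,\dots\}$. Let $(\mathcal Y_n)_{n\in\mathbb N}$ be independent homogeneous Poisson point processes on $\mathbb R$ with intensities $\lambda_n\in(0,\infty)$, regarded as random closed subsets of $\mathbb R$ (measurable with respect to the Borel $\sigma$-algebra of the Fell topology). Let $BV\subseteq\Omega$ be the set on which there is a function $f:\mathbb R\to\mathbb R$ of bounded variation (that is, of finite total variation on all of $\mathbb R$) such that $f(n)\in\mathcal Y_n$ for all $n\in\mathbb N$. Then $P[BV]=0$, i.e. $BV$ is contained in an event of probability $0$ (so that $BV$ is itself an event if the space is complete), provided that at least one of the following three conditions holds: (a) $(\lambda_n)_{n\in\mathbb N}$ is increasing (in the weak sense, $\lambda_n\le\lambda_{n+1}$) and $\sum_{n\in\mathbb N}\frac1{\lambda_n}=\infty$; (b) $\liminf_{n\to\infty}\lambda_n<\infty$; (c) $\lim_{n\to\infty}\lambda_n=\infty$ and $\limsup_{n\to\infty}\frac{n}{\lambda_{(n)}}>0$, where $(\lambda_{(n)})_{n\in\mathbb N}$ is the increasingly (in the weak sense) ordered permutation of $(\lambda_n)_{n\in\mathbb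 N}$. -/

import Mathlib

open MeasureTheory ProbabilityTheory Filter Set TopologicalSpace
open scoped NNReal ENNReal

/-- The Fell topology on the closed subsets of `ℝ`: it is generated by the sets of all closed `F`
that miss a given compact set, and the sets of all closed `F` that hit a given open set. -/
@[reducible] def fellTopology : TopologicalSpace (Closeds ℝ) :=
  TopologicalSpace.generateFrom
    ({A | ∃ K : Set ℝ, IsCompact K ∧ A = {F : Closeds ℝ | (F : Set ℝ) ∩ K = ∅}} ∪
      {A | ∃ U : Set ℝ, IsOpen U ∧ A = {F : Closeds ℝ | ((F : Set ℝ) ∩ U).Nonempty}})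

/-- The space of closed subsets of `ℝ` carries the Borel σ-algebra of the Fell topology. -/
instance fellMeasurableSpace : MeasurableSpace (Closeds ℝ) :=
  @borel (Closeds ℝ) fellTopology

/-- The number of points of the random set `Y` in `B`, possibly infinite. -/
noncomputable def pointCount {Ω : Type*} (Y : Ω → Closeds ℝ) (B : Set ℝ) (ω : Ω) : ℕ∞ :=
  ((Y ω : Set ℝ) ∩ B).encard

/-- The random closed set `Y` is a homogeneous Poisson point process on `ℝ` with intensity `r`:
the number of points in a bounded Borel set `B` is Poisson distributed with mean `r * |B|`
(in particular it is almost surely finite), and the numbers of points in finitely many pairwise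
disjoint bounded Borel sets are independent. -/
structure IsHomogeneousPoisson {Ω : Type*} [MeasurableSpace Ω] (P : Measure Ω)
    (Y : Ω → Closeds ℝ) (r : ℝ≥0) : Prop where
  measurable : Measurable Y
  hasLaw_pointCount : ∀ B : Set ℝ, MeasurableSet B → Bornology.IsBounded B →
    HasLaw (pointCount Y B)
      ((poissonMeasure (r * (volume B).toNNReal)).map (fun k : ℕ => (k : ℕ∞))) P
  indep_pointCount : ∀ (m : ℕ) (B : Fin m → Set ℝ), (∀ i, MeasurableSet (B i)) →
    (∀ i, Bornology.IsBounded (B i)) → (∀ i j, i ≠ j → Disjoint (B i) (B j)) →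
    iIndepFun (fun i => pointCount Y (B i)) P

/-- The condition (PPP) for the index set `{1, 2, 3, …}`: the `Y n` are independent homogeneous
Poisson point processes on `ℝ` with intensities `lam n > 0`. -/
structure IsPoissonFamily {Ω : Type*} [MeasurableSpace Ω] (P : Measure Ω)
    (Y : ℕ+ → Ω → Closeds ℝ) (lam : ℕ+ → ℝ≥0) : Prop where
  intensity_pos : ∀ n, 0 < lam n
  poisson : ∀ n, IsHomogeneousPoisson P (Y n) (lam n)
  indep : iIndepFun Y P

/-- The set of all functions `f : ℝ → ℝ` with `f n ∈ S n` for all `n = 1, 2, 3, …`. -/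
def interpolants (S : ℕ+ → Closeds ℝ) : Set (ℝ → ℝ) :=
  {f | ∀ n : ℕ+, f ((n : ℕ) : ℝ) ∈ S n}

/-- The event that some interpolating function has bounded variation on the whole of `ℝ`. -/
def eventBV {Ω : Type*} (Y : ℕ+ → Ω → Closeds ℝ) : Set Ω :=
  {ω | ∃ f ∈ interpolants (fun n => Y n ω), BoundedVariationOn f univ}

/-! The core is a first moment bound. Take `N + 1` processes of intensity at most `L` and cut the
line into cells of length `1/(24L)`. A path of variation at most `N/(24L)` has cell increments of
`ℓ¹`-norm at most `2N`, rounding included, so at most `12^N` increment vectors occur for each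
starting cell. By independence a given cell path is hit throughout with probability at most
`24^{-(N+1)}`. Hence such a path from `[-M, M]` exists with probability at most `(2ML + 1) 2^{-N}`
(`measure_exists_path_le`). Under (b) or (c), every tail of the indices contains, for arbitrarily
large `N`, `N + 1` indices with intensity at most `CN`. So almost surely every tail costs variation
at least `1/(24C)`, whereas the tail variations of a function of bounded variation tend to zero.
Under (a), the dyadic block from `2^k` to `2^{k+1}` costs `2^k/(24 λ_{2^{k+1}})` outside an event of
small probability. These costs have infinite sum by Cauchy condensation, and Borel–Cantelli leaves
only finitely many exceptional blocks. -/

lemma measurableSet_hits {K : Set ℝ} (hK : IsCompact K) :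
    MeasurableSet {F : Closeds ℝ | ((F : Set ℝ) ∩ K).Nonempty} := by
  have h : MeasurableSet {F : Closeds ℝ | (F : Set ℝ) ∩ K = ∅} :=
    MeasurableSpace.measurableSet_generateFrom
      (TopologicalSpace.isOpen_generateFrom_of_mem (Or.inl ⟨K, hK, rfl⟩))
  convert h.compl using 1
  ext F
  simp [Set.nonempty_iff_ne_empty]

lemma poissonMeasure_compl_zero_le (r : ℝ≥0) : poissonMeasure r {0}ᶜ ≤ r := by
  rw [prob_compl_eq_one_sub (measurableSet_singleton 0), poissonMeasure_singleton,
    ← ENNReal.ofReal_one, ← ENNReal.ofReal_sub _ (by positivity), ENNReal.ofReal_le_iff_le_toReal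
    (by simp)]
  have := Real.add_one_le_exp (-(r : ℝ))
  simp
  linarith

lemma IsHomogeneousPoisson.measure_hits_Icc_le {Ω : Type*} [MeasurableSpace Ω] {P : Measure Ω}
    {Y : Ω → Closeds ℝ} {r : ℝ≥0} (hY : IsHomogeneousPoisson P Y r) (a b : ℝ) :
    P {ω | ((Y ω : Set ℝ) ∩ Icc a b).Nonempty} ≤ r * ENNReal.ofReal (b - a) := by
  have hlaw := hY.hasLaw_pointCount (Icc a b) measurableSet_Icc (Metric.isBounded_Icc a b)
  have hm : MeasurableSet ({0}ᶜ : Set ℕ∞) := (measurableSet_singleton 0).compl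
  have e : {ω | ((Y ω : Set ℝ) ∩ Icc a b).Nonempty} = pointCount Y (Icc a b) ⁻¹' {0}ᶜ := by
    ext ω
    simp [pointCount, Set.nonempty_iff_ne_empty]
  have e2 : (fun k : ℕ => (k : ℕ∞)) ⁻¹' {0}ᶜ = {0}ᶜ := by
    ext k
    simp
  rw [e, ← Measure.map_apply_of_aemeasurable hlaw.aemeasurable hm, hlaw.map_eq,
    Measure.map_apply measurable_from_nat hm, e2]
  refine (poissonMeasure_compl_zero_le _).trans ?_
  rw [ENNReal.coe_mul, Real.volume_Icc]
  exact le_of_eq rfl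

lemma IsPoissonFamily.measure_forall_hits_le {Ω : Type*} [MeasurableSpace Ω] {P : Measure Ω}
    {Y : ℕ+ → Ω → Closeds ℝ} {lam : ℕ+ → ℝ≥0} (hY : IsPoissonFamily P Y lam)
    {ι : Type*} [Fintype ι] {t : ι → ℕ+} (ht : Function.Injective t) {L : ℝ≥0}
    (hL : ∀ i, lam (t i) ≤ L) (a : ι → ℝ) {d : ℝ} :
    P {ω | ∀ i, ((Y (t i) ω : Set ℝ) ∩ Icc (a i) (a i + d)).Nonempty} ≤
      (L * ENNReal.ofReal d) ^ Fintype.card ι := by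
  have hind := (hY.indep.precomp ht).measure_inter_preimage_eq_mul Finset.univ
    (sets := fun i => {F : Closeds ℝ | ((F : Set ℝ) ∩ Icc (a i) (a i + d)).Nonempty})
    (fun i _ => measurableSet_hits isCompact_Icc)
  have e : {ω | ∀ i, ((Y (t i) ω : Set ℝ) ∩ Icc (a i) (a i + d)).Nonempty} =
      ⋂ i ∈ Finset.univ, (Y (t i)) ⁻¹'
        {F : Closeds ℝ | ((F : Set ℝ) ∩ Icc (a i) (a i + d)).Nonempty} := by
    ext ω
    simp
  rw [e, hind, ← Finset.card_univ, ← Finset.prod_const]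
  refine Finset.prod_le_prod' fun i _ => ((hY.poisson (t i)).measure_hits_Icc_le _ _).trans ?_
  rw [add_sub_cancel_left]
  gcongr
  exact hL i

/-! ### Counting integer increment vectors -/

lemma sum_Icc_two_inv_pow_natAbs_le (K : ℕ) :
    ∑ j ∈ Finset.Icc (-(K : ℤ)) K, (2⁻¹ : ℝ) ^ j.natAbs ≤ 3 := by
  suffices h : ∑ j ∈ Finset.Icc (-(K : ℤ)) K, (2⁻¹ : ℝ) ^ j.natAbs = 3 - 2 * 2⁻¹ ^ K by
    rw [h]
    have : (0 : ℝ) ≤ 2 * 2⁻¹ ^ K := by positivity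
    linarith
  induction K with
  | zero => norm_num
  | succ K ih =>
    have e : Finset.Icc (-((K + 1 : ℕ) : ℤ)) ((K + 1 : ℕ) : ℤ) =
        insert (-((K : ℤ) + 1)) (insert ((K : ℤ) + 1) (Finset.Icc (-(K : ℤ)) K)) := by
      ext j
      simp only [Finset.mem_Icc, Finset.mem_insert]
      push_cast
      omega
    rw [e, Finset.sum_insert (by simp; omega), Finset.sum_insert (by simp), ih]
    have h1 : (-((K : ℤ) + 1)).natAbs = K + 1 := by omega
    have h2 : ((K : ℤ) + 1).natAbs = K + 1 := by omega
    rw [h1, h2, pow_succ]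
    ring

/-- The integer vectors of length `N` with `ℓ¹`-norm at most `K`. -/
noncomputable def l1Ball (N K : ℕ) : Finset (Fin N → ℤ) :=
  (Fintype.piFinset fun _ => Finset.Icc (-(K : ℤ)) K).filter fun d => ∑ i, (d i).natAbs ≤ K

lemma mem_l1Ball {N K : ℕ} {d : Fin N → ℤ} : d ∈ l1Ball N K ↔ ∑ i, (d i).natAbs ≤ K := by
  simp only [l1Ball, Finset.mem_filter, Fintype.mem_piFinset, Finset.mem_Icc, and_iff_right_iff_imp]
  intro h i
  have := (Finset.single_le_sum (f := fun i => (d i).natAbs) (fun _ _ => Nat.zero_le _)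
    (Finset.mem_univ i)).trans h
  omega

lemma l1Ball_subset (N K : ℕ) :
    l1Ball N K ⊆ Fintype.piFinset fun _ : Fin N => Finset.Icc (-(K : ℤ)) K := by
  rw [l1Ball]
  exact Finset.filter_subset _ _

/-- Weight `d` by `∏ 2^{-|d i|}`: on the ball the weight is at least `2^{-K}`, while the total over
the cube factorises into `N` sums, each at most 3. -/
lemma card_l1Ball_le (N K : ℕ) : ((l1Ball N K).card : ℝ) ≤ 3 ^ N * 2 ^ K := by
  have h1 : ∑ d ∈ l1Ball N K, (2⁻¹ : ℝ) ^ K ≤ ∑ d ∈ l1Ball N K, ∏ i, (2⁻¹ : ℝ) ^ (d i).natAbs := by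
    refine Finset.sum_le_sum fun d hd => ?_
    rw [Finset.prod_pow_eq_pow_sum]
    exact pow_le_pow_of_le_one (by norm_num) (by norm_num) (mem_l1Ball.1 hd)
  have h2 := Finset.sum_le_sum_of_subset_of_nonneg (l1Ball_subset N K)
    (f := fun d => ∏ i, (2⁻¹ : ℝ) ^ (d i).natAbs) fun _ _ _ => by positivity
  have h3 := Finset.sum_prod_piFinset (ι := Fin N) (Finset.Icc (-(K : ℤ)) K)
    fun _ j => (2⁻¹ : ℝ) ^ j.natAbs
  have h4 := pow_le_pow_left₀ (Finset.sum_nonneg fun _ _ => by positivity)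
    (sum_Icc_two_inv_pow_natAbs_le K) N
  rw [Finset.prod_const, Finset.card_univ, Fintype.card_fin] at h3
  have h : ((l1Ball N K).card : ℝ) * 2⁻¹ ^ K ≤ 3 ^ N := by
    rw [← nsmul_eq_mul, ← Finset.sum_const]
    exact h1.trans (h2.trans (h3.le.trans h4))
  rwa [inv_pow, ← div_eq_mul_inv, div_le_iff₀ (by positivity)] at h

/-! ### First moment bound for discretised paths -/

lemma natAbs_floor_sub_floor_le (x y : ℝ) : ((⌊x⌋ - ⌊y⌋).natAbs : ℝ) ≤ |x - y| + 1 := by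
  rw [Nat.cast_natAbs, Int.cast_abs, Int.cast_sub]
  have h1 := Int.floor_le x
  have h2 := Int.lt_floor_add_one x
  have h3 := Int.floor_le y
  have h4 := Int.lt_floor_add_one y
  have h5 := neg_abs_le (x - y)
  have h6 := le_abs_self (x - y)
  rw [abs_le]
  constructor <;> linarith

/-- First moment bound for the paths through `N + 1` processes with intensities at most `L`. -/
lemma IsPoissonFamily.measure_exists_path_le {Ω : Type*} [MeasurableSpace Ω] {P : Measure Ω}
    {Y : ℕ+ → Ω → Closeds ℝ} {lam : ℕ+ → ℝ≥0} (hY : IsPoissonFamily P Y lam)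
    {N : ℕ} {t : Fin (N + 1) → ℕ+} (ht : Function.Injective t) {L : ℝ≥0} (hL0 : 0 < L)
    (hL : ∀ i, lam (t i) ≤ L) {M : ℝ} (hM : 0 ≤ M) :
    P {ω | ∃ y : Fin (N + 1) → ℝ, (∀ i, y i ∈ Y (t i) ω) ∧ |y 0| ≤ M ∧
      ∑ i : Fin N, |y i.succ - y i.castSucc| ≤ N / (24 * L)} ≤
      ENNReal.ofReal ((2 * M * L + 1) * 2⁻¹ ^ N) := by
  have hL' : (0 : ℝ) < L := hL0
  -- A cell of length `c⁻¹` is hit with probability at most `1/24`, half the reciprocal of the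
  -- growth rate `12 = 3 * 2 ^ 2` of the number of increment vectors.
  set c : ℝ := 24 * L with hc
  have hc0 : 0 < c := by positivity
  set I : Finset ℤ := Finset.Icc ⌊-(M * c)⌋ ⌊M * c⌋ with hI
  set B := l1Ball N (2 * N) with hB
  let path : ℤ × (Fin N → ℤ) → Fin (N + 1) → ℝ := fun p i =>
    ((p.1 + Fin.partialSum p.2 i : ℤ) : ℝ) * c⁻¹
  have hsub : {ω | ∃ y : Fin (N + 1) → ℝ, (∀ i, y i ∈ Y (t i) ω) ∧ |y 0| ≤ M ∧
      ∑ i : Fin N, |y i.succ - y i.castSucc| ≤ N / c} ⊆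
      ⋃ p ∈ I ×ˢ B, {ω | ∀ i, ((Y (t i) ω : Set ℝ) ∩
        Icc (path p i) (path p i + c⁻¹)).Nonempty} := by
    rintro ω ⟨y, hy, hy0, hvar⟩
    let k : Fin (N + 1) → ℤ := fun i => ⌊y i * c⌋
    have hk : ∀ i, k 0 + Fin.partialSum (fun i : Fin N => -k i.castSucc + k i.succ) i = k i :=
      fun i => congrFun (Fin.partialSum_left_neg k) i
    simp only [Set.mem_iUnion, exists_prop]
    refine ⟨(k 0, fun i : Fin N => -k i.castSucc + k i.succ), Finset.mem_product.2 ⟨?_, ?_⟩, ?_⟩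
    · rw [abs_le] at hy0
      rw [hI, Finset.mem_Icc]
      exact ⟨Int.floor_le_floor (by nlinarith), Int.floor_le_floor (by nlinarith)⟩
    · rw [hB, mem_l1Ball]
      -- Rounding costs at most 1 per step, hence `N` in all; the scaled variation contributes at
      -- most another `N`.
      have h1 : ∑ i : Fin N, ((-k i.castSucc + k i.succ).natAbs : ℝ) ≤
          ∑ i : Fin N, (|y i.succ - y i.castSucc| * c + 1) := by
        refine Finset.sum_le_sum fun i _ => ?_
        have := natAbs_floor_sub_floor_le (y i.succ * c) (y i.castSucc * c)
        rw [← sub_mul, abs_mul, abs_of_pos hc0] at this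
        rwa [neg_add_eq_sub]
      rw [Finset.sum_add_distrib, ← Finset.sum_mul] at h1
      rw [le_div_iff₀ hc0] at hvar
      simp only [Finset.sum_const, Finset.card_univ, Fintype.card_fin, nsmul_eq_mul, mul_one] at h1
      have h2 : ((∑ i : Fin N, (-k i.castSucc + k i.succ).natAbs : ℕ) : ℝ) ≤ ((2 * N : ℕ) : ℝ) := by
        push_cast at h1 ⊢
        linarith
      exact_mod_cast h2
    · intro i
      refine ⟨y i, hy i, ?_⟩
      simp only [path, hk]
      have h1 := Int.floor_le (y i * c)
      have h2 := Int.lt_floor_add_one (y i * c)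
      constructor
      · rwa [← div_eq_mul_inv, div_le_iff₀ hc0]
      · rw [← add_one_mul, ← div_eq_mul_inv, le_div_iff₀ hc0]
        exact h2.le
  have hIcard : (I.card : ℝ) ≤ 2 * M * c + 2 := by
    have h0 : ⌊-(M * c)⌋ ≤ ⌊M * c⌋ := Int.floor_le_floor (by nlinarith)
    have h1 : ((I.card : ℤ) : ℝ) = ⌊M * c⌋ + 1 - ⌊-(M * c)⌋ := by
      rw [hI, Int.card_Icc, Int.toNat_of_nonneg (by omega)]
      push_cast
      ring
    have h2 := Int.floor_le (M * c)
    have h3 := Int.lt_floor_add_one (-(M * c))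
    rw [Int.cast_natCast] at h1
    rw [h1]
    linarith
  have hLc : (L : ℝ≥0∞) * ENNReal.ofReal c⁻¹ = ENNReal.ofReal 24⁻¹ := by
    rw [← ENNReal.ofReal_coe_nnreal, ← ENNReal.ofReal_mul hL'.le]
    congr 1
    rw [hc]
    field_simp
  refine (measure_mono hsub).trans ((measure_biUnion_finset_le _ _).trans ?_)
  refine (Finset.sum_le_card_nsmul _ _ _ fun p _ => hY.measure_forall_hits_le ht hL (path p)).trans
    ?_
  rw [hLc, Fintype.card_fin, nsmul_eq_mul, Finset.card_product, ← ENNReal.ofReal_pow (by norm_num),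
    ← ENNReal.ofReal_natCast, ← ENNReal.ofReal_mul (by positivity)]
  refine ENNReal.ofReal_le_ofReal ?_
  push_cast
  have hBcard : (B.card : ℝ) ≤ 12 ^ N := by
    refine (card_l1Ball_le N (2 * N)).trans (le_of_eq ?_)
    rw [pow_mul, ← mul_pow]
    norm_num
  calc (I.card : ℝ) * B.card * 24⁻¹ ^ (N + 1)
      ≤ (2 * M * c + 2) * 12 ^ N * 24⁻¹ ^ (N + 1) := by gcongr
    _ = (2 * M * L + 12⁻¹) * (12 * 24⁻¹) ^ N := by rw [mul_pow, pow_succ, hc]; ring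
    _ ≤ (2 * M * L + 1) * 2⁻¹ ^ N := by
      rw [show (12 : ℝ) * 24⁻¹ = 2⁻¹ by norm_num]
      gcongr
      norm_num

/-! ### From functions of bounded variation to finite paths -/

lemma sum_abs_sub_orderEmbOfFin_le (g : ℕ+ → ℝ) (S : Finset ℕ+) {N : ℕ} (hS : S.card = N + 1)
    {v : ℝ} (hv : 0 ≤ v) (h : eVariationOn g S ≤ ENNReal.ofReal v) :
    ∑ i : Fin N, |g (S.orderEmbOfFin hS i.succ) - g (S.orderEmbOfFin hS i.castSucc)| ≤ v := by
  -- Freezing the enumeration after its last point gives the monotone sequence on `ℕ` that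
  -- `eVariationOn.sum_le` expects.
  let u : ℕ → ℕ+ := fun n => S.orderEmbOfFin hS ⟨min n N, by omega⟩
  have hu : Monotone u := fun a b hab => (S.orderEmbOfFin hS).monotone
    (Fin.mk_le_mk.2 (min_le_min_right N hab))
  have h1 := (eVariationOn.sum_le (f := g) (s := (S : Set ℕ+)) (n := N) hu
    fun i => Finset.orderEmbOfFin_mem S hS _).trans h
  rw [← Fin.sum_univ_eq_sum_range (fun i => edist (g (u (i + 1))) (g (u i)))] at h1
  rw [← ENNReal.ofReal_le_ofReal_iff hv, ENNReal.ofReal_sum_of_nonneg fun _ _ => abs_nonneg _]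
  refine le_trans (le_of_eq (Finset.sum_congr rfl fun i _ => ?_)) h1
  rw [edist_dist, Real.dist_eq]
  have e1 : (⟨min (i.1 + 1) N, by omega⟩ : Fin (N + 1)) = i.succ := by
    ext; simp
  have e2 : (⟨min i.1 N, by omega⟩ : Fin (N + 1)) = i.castSucc := by
    ext; simp
  simp only [u, e1, e2]

/-- The event that there is a path through the processes with indices in `S` which stays in
`[-M, M]` and has variation at most `v`. -/
def shortPathEvent {Ω : Type*} (Y : ℕ+ → Ω → Closeds ℝ) (S : Set ℕ+) (M : ℝ) (v : ℝ≥0∞) :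
    Set Ω :=
  {ω | ∃ g : ℕ+ → ℝ, (∀ n ∈ S, g n ∈ Y n ω ∧ |g n| ≤ M) ∧ eVariationOn g S ≤ v}

lemma shortPathEvent_anti {Ω : Type*} (Y : ℕ+ → Ω → Closeds ℝ) {S T : Set ℕ+} (hST : S ⊆ T)
    (M : ℝ) (v : ℝ≥0∞) : shortPathEvent Y T M v ⊆ shortPathEvent Y S M v := by
  rintro ω ⟨g, hg, hv⟩
  exact ⟨g, fun n hn => hg n (hST hn), (eVariationOn.mono g hST).trans hv⟩

lemma IsPoissonFamily.measure_shortPathEvent_le {Ω : Type*} [MeasurableSpace Ω] {P : Measure Ω}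
    {Y : ℕ+ → Ω → Closeds ℝ} {lam : ℕ+ → ℝ≥0} (hY : IsPoissonFamily P Y lam)
    {S : Finset ℕ+} {N : ℕ} (hS : S.card = N + 1) {L : ℝ≥0} (hL0 : 0 < L)
    (hL : ∀ n ∈ S, lam n ≤ L) {M : ℝ} (hM : 0 ≤ M) :
    P (shortPathEvent Y S M (ENNReal.ofReal (N / (24 * L)))) ≤
      ENNReal.ofReal ((2 * M * L + 1) * 2⁻¹ ^ N) := by
  refine (measure_mono ?_).trans (hY.measure_exists_path_le (S.orderEmbOfFin hS).injective hL0
    (fun i => hL _ (Finset.orderEmbOfFin_mem S hS i)) hM)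
  rintro ω ⟨g, hg, hv⟩
  exact ⟨fun i => g (S.orderEmbOfFin hS i), fun i => (hg _ (Finset.orderEmbOfFin_mem S hS i)).1,
    (hg _ (Finset.orderEmbOfFin_mem S hS 0)).2,
    sum_abs_sub_orderEmbOfFin_le g S hS (by positivity) hv⟩

/-- Bounded variation implies boundedness; a natural number as bound keeps later unions over `M`
countable. -/
lemma exists_path_of_mem_eventBV {Ω : Type*} {Y : ℕ+ → Ω → Closeds ℝ} {ω : Ω}
    (h : ω ∈ eventBV Y) : ∃ (g : ℕ+ → ℝ) (M : ℕ),
      (∀ n, g n ∈ Y n ω ∧ |g n| ≤ M) ∧ BoundedVariationOn g univ := by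
  obtain ⟨f, hf, hbv⟩ := h
  have hmono : Monotone fun n : ℕ+ => ((n : ℕ) : ℝ) := fun a b hab => by
    exact Nat.cast_le.2 hab
  have hg : BoundedVariationOn (fun n : ℕ+ => f ((n : ℕ) : ℝ)) univ :=
    ne_top_of_le_ne_top hbv
      (eVariationOn.comp_le_of_monotoneOn f (fun n : ℕ+ => ((n : ℕ) : ℝ)) (hmono.monotoneOn univ)
        (mapsTo_univ _ _))
  obtain ⟨M, hM⟩ := exists_nat_ge (|f 1| + (eVariationOn f univ).toReal)
  refine ⟨fun n => f ((n : ℕ) : ℝ), M, fun n => ⟨hf n, ?_⟩, hg⟩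
  have h1 := hbv.dist_le (mem_univ ((n : ℕ) : ℝ)) (mem_univ 1)
  rw [Real.dist_eq] at h1
  have h2 := abs_sub_abs_le_abs_sub (f ((n : ℕ) : ℝ)) (f 1)
  linarith

/-! ### Two criteria: variation on tails and variation on blocks -/

lemma IsPoissonFamily.measure_eventBV_eq_zero_of_frequently {Ω : Type*} [MeasurableSpace Ω]
    {P : Measure Ω} {Y : ℕ+ → Ω → Closeds ℝ} {lam : ℕ+ → ℝ≥0} (hY : IsPoissonFamily P Y lam)
    {C : ℝ≥0} (hC : 0 < C)
    (h : ∀ (m : ℕ+) (K : ℕ), ∃ N, K ≤ N ∧ 0 < N ∧ ∃ S : Finset ℕ+, (S : Set ℕ+) ⊆ Ici m ∧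
      S.card = N + 1 ∧ ∀ n ∈ S, lam n ≤ C * N) :
    P (eventBV Y) = 0 := by
  have hC' : (0 : ℝ) < C := hC
  set v : ℝ≥0∞ := ENNReal.ofReal (1 / (24 * C)) with hv
  have hv0 : 0 < v := ENNReal.ofReal_pos.2 (by positivity)
  -- With `L = C * N` the threshold `N/(24L)` does not depend on `N`, so one fixed event has
  -- probability at most `(2MCN + 1) 2^{-N}` for arbitrarily large `N`.
  have hnull : ∀ (m : ℕ+) (M : ℕ), P (shortPathEvent Y (Ici m) M v) = 0 := by
    intro m M
    have hlim : Tendsto (fun N : ℕ => ENNReal.ofReal ((2 * M * (C * N) + 1) * 2⁻¹ ^ N)) atTop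
        (nhds 0) := by
      have h1 := tendsto_self_mul_const_pow_of_lt_one (r := (2⁻¹ : ℝ)) (by norm_num) (by norm_num)
      have h2 := tendsto_pow_atTop_nhds_zero_of_lt_one (r := (2⁻¹ : ℝ)) (by norm_num) (by norm_num)
      have h3 := (h1.const_mul (2 * M * C : ℝ)).add h2
      rw [← ENNReal.ofReal_zero]
      refine ENNReal.tendsto_ofReal ?_
      convert h3 using 2
      · ring
      · simp
    refine nonpos_iff_eq_zero.1 (ge_of_tendsto_of_frequently hlim (frequently_atTop.2 fun K => ?_))
    obtain ⟨N, hKN, hN, S, hSm, hS, hlam⟩ := h m K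
    have hN' : (0 : ℝ) < N := by exact_mod_cast hN
    refine ⟨N, hKN, (measure_mono (shortPathEvent_anti Y hSm M v)).trans ?_⟩
    have := hY.measure_shortPathEvent_le hS (L := C * N) (by positivity) hlam (M := M)
      (by positivity)
    push_cast at this
    have e : (N : ℝ) / (24 * (C * N)) = 1 / (24 * C) := by field_simp
    rwa [e] at this
  refine measure_mono_null (t := ⋃ (m : ℕ+) (M : ℕ), shortPathEvent Y (Ici m) M v) ?_
    (measure_iUnion_null fun m => measure_iUnion_null fun M => hnull m M)
  intro ω hω
  obtain ⟨g, M, hg, hbv⟩ := exists_path_of_mem_eventBV hω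
  have ht := hbv.tendsto_eVariationOn_Ici_zero_of_filter atTop
    (fun y _ => by simpa using Ici_mem_atTop y)
  obtain ⟨m, hm⟩ := (ht.eventually (gt_mem_nhds hv0)).exists
  rw [univ_inter] at hm
  simp only [mem_iUnion]
  exact ⟨m, M, g, fun n _ => hg n, hm.le⟩

/-- Variation is superadditive over successive blocks; these may share an endpoint. -/
lemma eVariationOn_sum_le {α ι : Type*} [LinearOrder α] [LinearOrder ι] (g : α → ℝ)
    (S : ι → Set α) (hS : ∀ i j, i < j → ∀ a ∈ S i, ∀ b ∈ S j, a ≤ b) (F : Finset ι) :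
    ∑ i ∈ F, eVariationOn g (S i) ≤ eVariationOn g (⋃ i ∈ F, S i) := by
  induction F using Finset.induction_on_max with
  | empty => simp
  | insert i F hi ih =>
    rw [Finset.sum_insert fun hmem => lt_irrefl i (hi i hmem), Finset.set_biUnion_insert, add_comm,
      union_comm]
    refine (add_le_add_left ih _).trans (eVariationOn.add_le_union g fun a ha b hb => ?_)
    simp only [mem_iUnion] at ha
    obtain ⟨j, hj, ha⟩ := ha
    exact hS j i (hi j hj) a ha b hb

/-- If consecutive blocks of indices force variations that add up to infinity, outside of events
with summable probabilities, then there is no interpolation of bounded variation. -/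
lemma measure_eventBV_eq_zero_of_blocks {Ω ι : Type*} [MeasurableSpace Ω] [LinearOrder ι] [Countable ι]
    {P : Measure Ω} {Y : ℕ+ → Ω → Closeds ℝ} (S : ι → Set ℕ+)
    (hS : ∀ i j, i < j → ∀ a ∈ S i, ∀ b ∈ S j, a ≤ b) (v : ι → ℝ≥0∞) (hv : ∀ i, v i ≠ ∞)
    (hsum : ∑' i, v i = ∞) (hP : ∀ M : ℕ, ∑' i, P (shortPathEvent Y (S i) M (v i)) ≠ ∞) :
    P (eventBV Y) = 0 := by
  have hae : ∀ᵐ ω ∂P, ∀ M : ℕ, {i | ω ∈ shortPathEvent Y (S i) M (v i)}.Finite :=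
    ae_all_iff.2 fun M => ae_finite_setOfPred_mem (hP M)
  refine measure_mono_null ?_ (ae_iff.1 hae)
  intro ω hω hfin
  obtain ⟨g, M, hg, hbv⟩ := exists_path_of_mem_eventBV hω
  -- The finitely many exceptional blocks from Borel–Cantelli have finite total cost; every other
  -- block forces variation more than `v i`.
  set B := (hfin M).toFinset with hB
  have hle : ∑' i, v i ≤ ∑ i ∈ B, v i + eVariationOn g univ := by
    rw [ENNReal.tsum_eq_iSup_sum]
    refine iSup_le fun F => ?_
    classical
    rw [← Finset.sum_inter_add_sum_sdiff F B]
    refine add_le_add (Finset.sum_le_sum_of_subset Finset.inter_subset_right) ?_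
    refine le_trans (Finset.sum_le_sum fun i hi => ?_) ((eVariationOn_sum_le g S hS (F \ B)).trans
      (eVariationOn.mono g (subset_univ _)))
    by_contra! hlt
    refine (Finset.mem_sdiff.1 hi).2 ?_
    rw [hB, Set.Finite.mem_toFinset]
    exact ⟨g, fun n _ => hg n, hlt.le⟩
  rw [hsum, top_le_iff] at hle
  exact ENNReal.add_ne_top.2 ⟨ENNReal.sum_ne_top.2 fun i _ => hv i, hbv⟩ hle

/-! ### Conditions (b) and (c) -/

lemma IsPoissonFamily.measure_eventBV_eq_zero_of_liminf_lt_top {Ω : Type*} [MeasurableSpace Ω]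
    {P : Measure Ω} {Y : ℕ+ → Ω → Closeds ℝ} {lam : ℕ+ → ℝ≥0} (hY : IsPoissonFamily P Y lam)
    (h : liminf (fun n => (lam n : ℝ≥0∞)) atTop < ∞) : P (eventBV Y) = 0 := by
  obtain ⟨C, hC1, hC2⟩ := exists_between h
  lift C to ℝ≥0 using hC2.ne
  have hfreq : ∃ᶠ n in atTop, lam n < C :=
    (frequently_lt_of_liminf_lt (by isBoundedDefault) hC1).mono fun n hn => by exact_mod_cast hn
  obtain ⟨n₀, hn₀⟩ := hfreq.exists
  refine hY.measure_eventBV_eq_zero_of_frequently (C := C) (pos_of_gt hn₀) fun m K => ?_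
  have hinf : ({n | lam n < C} ∩ Ici m).Infinite := by
    rw [Set.infinite_iff_exists_gt]
    intro a
    obtain ⟨b, hb, hlt⟩ := frequently_atTop.1 hfreq (max m (a + 1))
    exact ⟨b, ⟨hlt, (le_max_left _ _).trans hb⟩,
      (PNat.lt_add_right a 1).trans_le ((le_max_right _ _).trans hb)⟩
  obtain ⟨S, hS, hcard⟩ := hinf.exists_subset_card_eq (K + 1 + 1)
  refine ⟨K + 1, by omega, by omega, S, fun n hn => (hS hn).2, hcard, fun n hn => ?_⟩
  refine (hS hn).1.le.trans (le_mul_of_one_le_right zero_le ?_)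
  push_cast
  exact le_add_of_nonneg_left zero_le

lemma IsPoissonFamily.measure_eventBV_eq_zero_of_limsup_pos {Ω : Type*} [MeasurableSpace Ω]
    {P : Measure Ω} {Y : ℕ+ → Ω → Closeds ℝ} {lam : ℕ+ → ℝ≥0} (hY : IsPoissonFamily P Y lam)
    (σ : Equiv.Perm ℕ+) (hσ : Monotone fun n => lam (σ n))
    (h : 0 < limsup (fun n : ℕ+ => ((n : ℕ) : ℝ≥0∞) / (lam (σ n) : ℝ≥0∞)) atTop) :
    P (eventBV Y) = 0 := by
  obtain ⟨ε, hε0, hε⟩ := exists_between h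
  lift ε to ℝ≥0 using hε.ne_top
  have hε0' : 0 < ε := by exact_mod_cast hε0
  have hfreq := frequently_lt_of_lt_limsup (by isBoundedDefault) hε
  refine hY.measure_eventBV_eq_zero_of_frequently (C := 2 / ε) (by positivity) fun m K => ?_
  -- Of the `n` indices with smallest intensities, discarding the at most `m - 1` below `m` leaves
  -- `N + 1` with `N = n - m`. As `n ≥ 2m`, `n ≤ 2N`, which accounts for the 2 in `C = 2 / ε`.
  obtain ⟨n, hn, hlt⟩ := frequently_atTop.1 hfreq ⟨2 * m + K + 1, by omega⟩
  have hn' : 2 * (m : ℕ) + K + 1 ≤ n := hn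
  have hm := m.pos
  rw [ENNReal.lt_div_iff_mul_lt (Or.inl (by exact_mod_cast (hY.intensity_pos _).ne'))
    (Or.inl ENNReal.coe_ne_top)] at hlt
  have hlt' : ε * lam (σ n) < n := by exact_mod_cast hlt
  have hcard : (n : ℕ) - m + 1 ≤
      ((Finset.Icc 1 n).map σ.toEmbedding \ Finset.Ico 1 m).card := by
    refine le_trans ?_ (Finset.le_card_sdiff _ _)
    rw [Finset.card_map, PNat.card_Icc, PNat.card_Ico]
    simp only [PNat.one_coe]
    omega
  obtain ⟨S, hS, hScard⟩ := Finset.exists_subset_card_eq hcard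
  refine ⟨n - m, by omega, by omega, S, fun a ha => ?_, hScard, fun a ha => ?_⟩
  · have := (Finset.mem_sdiff.1 (hS ha)).2
    simpa using this
  · obtain ⟨i, hi, rfl⟩ := Finset.mem_map.1 (Finset.mem_sdiff.1 (hS ha)).1
    have h1 : lam (σ i) ≤ lam (σ n) := hσ (Finset.mem_Icc.1 hi).2
    have h2 : (n : ℝ≥0) ≤ 2 * ((n - m : ℕ) : ℝ≥0) := by
      exact_mod_cast (show (n : ℕ) ≤ 2 * (n - m) by omega)
    rw [div_mul_eq_mul_div, le_div_iff₀ hε0', mul_comm]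
    calc ε * lam (σ i) ≤ ε * lam (σ n) := by gcongr
      _ ≤ n := hlt'.le
      _ ≤ _ := h2

/-! ### Condition (a): dyadic blocks -/

lemma three_mul_le_three_add_two_pow (k : ℕ) : 3 * k ≤ 3 + 2 ^ k := by
  obtain hk | hk := lt_or_ge k 2
  · interval_cases k <;> norm_num
  · obtain ⟨j, rfl⟩ := Nat.exists_eq_add_of_le hk
    have := Nat.lt_two_pow_self (n := j)
    rw [pow_add]
    omega

lemma four_pow_mul_two_inv_pow_two_pow_le (k : ℕ) :
    (4 : ℝ) ^ k * 2⁻¹ ^ 2 ^ k ≤ 8 * 2⁻¹ ^ k := by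
  rw [inv_pow, inv_pow, ← div_eq_mul_inv, ← div_eq_mul_inv, div_le_div_iff₀ (by positivity)
    (by positivity)]
  calc (4 : ℝ) ^ k * 2 ^ k = 2 ^ (3 * k) := by
        rw [← mul_pow, pow_mul]
        norm_num
    _ ≤ 2 ^ (3 + 2 ^ k) := pow_le_pow_right₀ (by norm_num) (three_mul_le_three_add_two_pow k)
    _ = 8 * 2 ^ 2 ^ k := by
        rw [pow_add]
        norm_num

lemma tsum_ofReal_const_mul_two_inv_pow_ne_top {c : ℝ} :
    ∑' k : ℕ, ENNReal.ofReal (c * 2⁻¹ ^ k) ≠ ∞ :=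
  ((summable_geometric_of_lt_one (by norm_num) (by norm_num)).mul_left c).tsum_ofReal_ne_top

lemma tsum_dyadic_eq_top {lam : ℕ+ → ℝ≥0} (hpos : ∀ n, 0 < lam n) (hmono : Monotone lam)
    (h : ∑' n, 1 / (lam n : ℝ≥0∞) = ∞) :
    ∑' k : ℕ, ENNReal.ofReal ((2 ^ k : ℕ) / (24 * lam (2 ^ (k + 1)))) = ∞ := by
  have hpos' : ∀ n, (0 : ℝ) < lam n := fun n => hpos n
  -- `toPNat'` sends 0 to 1, so the spurious term `f 0` is finite and harmless.
  set f : ℕ → ℝ≥0∞ := fun k => 1 / (lam k.toPNat' : ℝ≥0∞) with hf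
  have hf_ne : ∀ k, f k ≠ ∞ := fun k => by
    simp [hf, (hpos _).ne']
  have hanti : ∀ ⦃m n⦄, 0 < m → m ≤ n → f n ≤ f m := by
    intro m n hm hmn
    simp only [hf]
    gcongr
    refine hmono ?_
    rw [← PNat.coe_le_coe, Nat.toPNat'_coe, Nat.toPNat'_coe, if_pos hm, if_pos (hm.trans_le hmn)]
    exact hmn
  have h1 : ∑' k, f k = ∞ := by
    refine top_le_iff.1 (h ▸ ?_)
    refine le_trans (le_of_eq (tsum_congr fun n => ?_))
      (ENNReal.tsum_comp_le_tsum_of_injective PNat.coe_injective f)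
    simp [hf]
  have h2 := ENNReal.le_tsum_condensed hanti
  rw [h1, top_le_iff, ENNReal.add_eq_top, or_iff_right (hf_ne 0),
    tsum_eq_zero_add' ENNReal.summable, ENNReal.add_eq_top,
    or_iff_right (ENNReal.mul_ne_top (by simp) (hf_ne _))] at h2
  have h3 : ∀ k : ℕ, (2 : ℝ≥0∞) ^ (k + 1) * f (2 ^ (k + 1)) =
      ENNReal.ofReal 48 * ENNReal.ofReal ((2 ^ k : ℕ) / (24 * lam (2 ^ (k + 1)))) := by
    intro k
    have e : (2 ^ (k + 1) : ℕ).toPNat' = (2 : ℕ+) ^ (k + 1) := by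
      rw [← PNat.coe_inj, Nat.toPNat'_coe, if_pos (by positivity), PNat.pow_coe]
      rfl
    have e2 : (2 : ℝ≥0∞) ^ (k + 1) = ENNReal.ofReal (2 ^ (k + 1)) := by
      rw [ENNReal.ofReal_pow (by norm_num)]
      simp
    have e3 : f (2 ^ (k + 1)) = ENNReal.ofReal (1 / lam (2 ^ (k + 1))) := by
      rw [ENNReal.ofReal_div_of_pos (hpos' _)]
      simp [hf, e]
    have := hpos' (2 ^ (k + 1))
    rw [e2, e3, ← ENNReal.ofReal_mul (by positivity), ← ENNReal.ofReal_mul (by positivity)]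
    congr 1
    push_cast
    field_simp
    ring
  rw [tsum_congr h3, ENNReal.tsum_mul_left] at h2
  by_contra hne
  exact ENNReal.mul_ne_top ENNReal.ofReal_ne_top hne h2

lemma IsPoissonFamily.measure_eventBV_eq_zero_of_monotone {Ω : Type*} [MeasurableSpace Ω]
    {P : Measure Ω} {Y : ℕ+ → Ω → Closeds ℝ} {lam : ℕ+ → ℝ≥0} (hY : IsPoissonFamily P Y lam)
    (hmono : Monotone lam) (h : ∑' n, 1 / (lam n : ℝ≥0∞) = ∞) : P (eventBV Y) = 0 := by
  have hpos' : ∀ n, (0 : ℝ) < lam n := fun n => hY.intensity_pos n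
  set L : ℕ → ℝ≥0 := fun k => lam (2 ^ (k + 1)) with hL
  set v : ℕ → ℝ≥0∞ := fun k => ENNReal.ofReal ((2 ^ k : ℕ) / (24 * L k)) with hv
  -- Blocks outside `G` cost at most `2^{-k}`, so dropping them keeps the sum infinite; on `G` the
  -- factor `L k` in the probability bound is beaten by `2^{-2^k}`.
  set G : Set ℕ := {k | L k ≤ 4 ^ k} with hG
  have hcompl : ∑' k : ↥Gᶜ, v k ≠ ∞ := by
    refine ne_top_of_le_ne_top (tsum_ofReal_const_mul_two_inv_pow_ne_top (c := 1))
      (le_trans (ENNReal.tsum_le_tsum fun k => ?_) (ENNReal.tsum_comp_le_tsum_of_injective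
        (Subtype.val_injective (p := (· ∈ Gᶜ))) _))
    refine ENNReal.ofReal_le_ofReal ?_
    have hk : (4 : ℝ) ^ (k : ℕ) ≤ L k := by
      have := (not_le.1 (show ¬ L k ≤ 4 ^ (k : ℕ) from k.2)).le
      exact_mod_cast this
    have h4 : (4 : ℝ) ^ (k : ℕ) = 2 ^ (k : ℕ) * 2 ^ (k : ℕ) := by
      rw [← mul_pow]
      norm_num
    have : (0 : ℝ) < L k := hpos' _
    push_cast
    rw [one_mul, inv_pow, ← one_div, div_le_div_iff₀ (by positivity) (by positivity), ← h4]
    linarith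
  have hsum : ∑' k : ↥G, v k = ∞ := by
    have h1 : ∑' k, v k = ∞ := tsum_dyadic_eq_top hY.intensity_pos hmono h
    rw [← ENNReal.summable.tsum_add_tsum_compl (s := G) ENNReal.summable, ENNReal.add_eq_top] at h1
    exact h1.resolve_right hcompl
  refine measure_eventBV_eq_zero_of_blocks (ι := G)
    -- Including both endpoints gives exactly `2^k + 1` indices, so `N = 2^k`.
    (fun k => (Finset.Icc ((2 : ℕ+) ^ (k : ℕ)) (2 ^ ((k : ℕ) + 1)) : Set ℕ+)) ?_ (fun k => v k)
    (fun k => ENNReal.ofReal_ne_top) hsum fun M => ?_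
  · intro i j hij a ha b hb
    simp only [Finset.coe_Icc, mem_Icc] at ha hb
    exact ha.2.trans ((pow_le_pow_right' (by decide) (Nat.succ_le_of_lt hij)).trans hb.1)
  · refine ne_top_of_le_ne_top (tsum_ofReal_const_mul_two_inv_pow_ne_top (c := (2 * M + 1) * 8))
      (le_trans (ENNReal.tsum_le_tsum fun k => ?_) (ENNReal.tsum_comp_le_tsum_of_injective
        (Subtype.val_injective (p := (· ∈ G))) _))
    have hcard : (Finset.Icc ((2 : ℕ+) ^ (k : ℕ)) (2 ^ ((k : ℕ) + 1))).card = 2 ^ (k : ℕ) + 1 := by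
      rw [PNat.card_Icc, PNat.pow_coe, PNat.pow_coe, pow_succ]
      simp only [PNat.val_ofNat]
      omega
    refine (hY.measure_shortPathEvent_le hcard (L := L k) (hY.intensity_pos _)
      (fun n hn => hmono (Finset.mem_Icc.1 hn).2) (M := M) (by positivity)).trans
        (ENNReal.ofReal_le_ofReal ?_)
    have hk : (L k : ℝ) ≤ 4 ^ (k : ℕ) := by
      have : L k ≤ 4 ^ (k : ℕ) := k.2
      exact_mod_cast this
    have h1 : (1 : ℝ) ≤ 4 ^ (k : ℕ) := one_le_pow₀ (by norm_num)
    calc (2 * (M : ℝ) * L k + 1) * (2⁻¹ : ℝ) ^ 2 ^ (k : ℕ)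
        ≤ (2 * (M : ℝ) * 4 ^ (k : ℕ) + 4 ^ (k : ℕ)) * (2⁻¹ : ℝ) ^ 2 ^ (k : ℕ) := by gcongr
      _ = (2 * (M : ℝ) + 1) * (4 ^ (k : ℕ) * (2⁻¹ : ℝ) ^ 2 ^ (k : ℕ)) := by ring
      _ ≤ (2 * (M : ℝ) + 1) * (8 * (2⁻¹ : ℝ) ^ (k : ℕ)) :=
        mul_le_mul_of_nonneg_left (four_pow_mul_two_inv_pow_two_pow_le k) (by positivity)
      _ = (2 * (M : ℝ) + 1) * 8 * (2⁻¹ : ℝ) ^ (k : ℕ) := by ring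

theorem theorem4 {Ω : Type*} [MeasurableSpace Ω] (P : Measure Ω) [IsProbabilityMeasure P]
    (Y : ℕ+ → Ω → Closeds ℝ) (lam : ℕ+ → ℝ≥0) (hY : IsPoissonFamily P Y lam)
    (h :
      (Monotone lam ∧ ∑' n, 1 / (lam n : ℝ≥0∞) = ∞) ∨
      liminf (fun n => (lam n : ℝ≥0∞)) atTop < ∞ ∨
      (Tendsto lam atTop atTop ∧
        ∃ σ : Equiv.Perm ℕ+, Monotone (fun n => lam (σ n)) ∧
          0 < limsup (fun n : ℕ+ => ((n : ℕ) : ℝ≥0∞) / (lam (σ n) : ℝ≥0∞)) atTop)) :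
    P (eventBV Y) = 0 := by
  obtain ⟨hmono, hsum⟩ | hlim | ⟨-, σ, hσ, hlim⟩ := h
  · exact hY.measure_eventBV_eq_zero_of_monotone hmono hsum
  · exact hY.measure_eventBV_eq_zero_of_liminf_lt_top hlim
  · exact hY.measure_eventBV_eq_zero_of_limsup_pos σ hσ hlim
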